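/- All maps and homotopies are based. Let $(A,a_0)$, $(\tilde X,\tilde x_0)$ and $(X,x_0)$ be path-connected pointed spaces (for instance, path-connected spaces of the homotopy type of a CW-complex). For a map $f\colon A\to X$ and $m\ge 1$, the generalized Gottlieb group $G_m^f(X)\subseteq\pi_m(X,x_0)$ is the subgroup of all elements that can be represented by a map $\alpha\colon\mathbb S^m\to X$ such that $f\vee\alpha\colon A\vee\mathbb S^m\to X$ extends, up to homotopy, to a map $F\colon A\times\mathbb S^m\to X$. The generalized Whitehead center group $P_m^f(X)\subseteq\pi_m(X,x_0)$ is the subgroup of all $\alpha\in\pi_m(X,x_0)$ whose Whitehead products $[\alpha,f_*\beta]$ vanish for all $\beta\in\pi_l(A,a_0)$ and all $l\ge 1$. **Theorem.** Let $p\colon\tilde X\to X$ be a covering map and $f\colon A\to\tilde X$ a map. Then for every $m\ge 1$ the homomorphism $p_*\colon\pi_m(\tilde X,\tilde x_0)\to\pi_m(X,x_0)$ is injective, and $$G_m^f(\tilde X)=p_*^{-1}\bigl(G_m^{pf}(X)\bigr),\qquad P_m^f(\tilde X)=p_*^{-1}\bigl(P_m^{pf}(X)\bigr).$$ Hence for $m>1$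 the homomorphism $p_*$ is an isomorphism and restricts to isomorphisms of groups $G_m^f(\tilde X)\cong G_m^{pf}(X)$ and $P_m^f(\tilde X)\cong P_m^{pf}(X)$. -/

import Mathlib

open scoped unitInterval Topology Topology.Homotopy

noncomputable section

namespace GenGottlieb

/-! ### Induced maps on homotopy groups -/

section Induced

variable {X Y : Type*} [TopologicalSpace X] [TopologicalSpace Y]

/-- Composition of a generalized loop `(I^m, ∂I^m) → (X, x)` with a based map `(X, x) → (Y, y)`. -/
def compLoop {m : ℕ} {x : X} {y : Y} (h : C(X, Y)) (hx : h x = y) (α : GenLoop (Fin m) X x) :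
    GenLoop (Fin m) Y y :=
  ⟨h.comp α.1, fun t ht => by
    have := α.2 t ht
    simp only [ContinuousMap.comp_apply, this, hx]⟩

/-- The homomorphism `h_* : π_m(X, x) → π_m(Y, y)` induced by a based map `h`, for `m ≥ 1`. -/
def piMap (m : ℕ) [NeZero m] {x : X} {y : Y} (h : C(X, Y)) (hx : h x = y) :
    π_ m X x →* π_ m Y y :=
  MonoidHom.mk'
    (Quotient.map (compLoop h hx)
      (fun _ _ H => ContinuousMap.HomotopicRel.comp_continuousMap H h))
    (by
      rintro ⟨a⟩ ⟨b⟩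
      have e1 := HomotopyGroup.mul_spec (i := (0 : Fin m)) (p := a) (q := b)
      have e2 := HomotopyGroup.mul_spec (i := (0 : Fin m)) (p := compLoop h hx a)
        (q := compLoop h hx b)
      refine (congrArg _ e1).trans (Eq.trans ?_ e2.symm)
      refine congrArg (Quotient.mk _) ?_
      ext t
      change h (if _ then _ else _) = (if _ then _ else _)
      split_ifs <;> rfl)

end Induced

/-! ### Pointed homotopy classes and the Whitehead product -/

section Pointed

variable {Y X : Type*} [TopologicalSpace Y] [TopologicalSpace X]

/-- Based maps `(Y, y₀) → (X, x₀)`. -/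
def BasedMap (y₀ : Y) (x₀ : X) : Type _ := {w : C(Y, X) // w y₀ = x₀}

/-- Based homotopy of based maps. -/
def basedSetoid (y₀ : Y) (x₀ : X) : Setoid (BasedMap y₀ x₀) where
  r v w := ContinuousMap.HomotopicRel v.1 w.1 {y₀}
  iseqv := ⟨fun _ => ContinuousMap.HomotopicRel.refl _, fun h => h.symm, fun h k => h.trans k⟩

/-- The set `[(Y, y₀), (X, x₀)]` of based homotopy classes of based maps. -/
def BasedClasses (y₀ : Y) (x₀ : X) : Type _ := Quotient (basedSetoid y₀ x₀)

/-- The class of the constant map. -/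
instance (y₀ : Y) (x₀ : X) : Zero (BasedClasses y₀ x₀) :=
  ⟨Quotient.mk (basedSetoid y₀ x₀) ⟨ContinuousMap.const Y x₀, rfl⟩⟩

end Pointed

/-- The boundary `∂(I^m × I^l) = (∂I^m × I^l) ∪ (I^m × ∂I^l)`, a sphere of dimension `m + l - 1`. -/
def prodBoundary (m l : ℕ) : Set ((I^ Fin m) × (I^ Fin l)) :=
  {w | w.1 ∈ Cube.boundary (Fin m) ∨ w.2 ∈ Cube.boundary (Fin l)}

theorem zero_mem_boundary (m : ℕ) [NeZero m] : (0 : I^ Fin m) ∈ Cube.boundary (Fin m) :=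
  ⟨0, Or.inl rfl⟩

/-- The base point `(0, 0)` of `∂(I^m × I^l)`; it lies in `∂I^m × ∂I^l`. -/
def basePt (m l : ℕ) [NeZero m] : prodBoundary m l :=
  ⟨(0, 0), Or.inl (zero_mem_boundary m)⟩

theorem isClosed_boundary (m : ℕ) : IsClosed (Cube.boundary (Fin m)) := by
  have : Cube.boundary (Fin m) = ⋃ i, {y : I^ Fin m | y i = 0 ∨ y i = 1} := by
    ext y; simp [Cube.boundary]
  rw [this]
  refine isClosed_iUnion_of_finite fun i => ?_
  exact (isClosed_eq (continuous_apply i) continuous_const).union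
    (isClosed_eq (continuous_apply i) continuous_const)

/-- Gluing two maps along a closed cover. -/
theorem continuous_glue {Y X : Type*} [TopologicalSpace Y] [TopologicalSpace X] {f g₁ g₂ : Y → X}
    {C₁ C₂ : Set Y} (h₁ : IsClosed C₁) (h₂ : IsClosed C₂) (hc : ∀ y, y ∈ C₁ ∨ y ∈ C₂)
    (c₁ : ContinuousOn g₁ C₁) (c₂ : ContinuousOn g₂ C₂)
    (e₁ : ∀ y ∈ C₁, f y = g₁ y) (e₂ : ∀ y ∈ C₂, f y = g₂ y) : Continuous f := by
  have : C₁ ∪ C₂ = Set.univ := Set.eq_univ_of_forall hc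
  rw [← continuousOn_univ, ← this]
  exact (c₁.congr e₁).union_of_isClosed (c₂.congr e₂) h₁ h₂

section Whitehead

variable {X : Type*} [TopologicalSpace X] {x : X} {m l : ℕ}

open Classical in
/-- The map `∂(I^m × I^l) → X` which is `(s, t) ↦ α s` on `I^m × ∂I^l` and `(s, t) ↦ β t` on
`∂I^m × I^l` (both are constant on `∂I^m × ∂I^l`). -/
def whiteheadMap (α : GenLoop (Fin m) X x) (β : GenLoop (Fin l) X x) : C(prodBoundary m l, X) where
  toFun w := if w.1.1 ∈ Cube.boundary (Fin m) then β w.1.2 else α w.1.1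
  continuous_toFun := by
    refine continuous_glue (g₁ := fun w => β w.1.2) (g₂ := fun w => α w.1.1)
      (C₁ := {w | w.1.1 ∈ Cube.boundary (Fin m)}) (C₂ := {w | w.1.2 ∈ Cube.boundary (Fin l)})
      ((isClosed_boundary m).preimage (by fun_prop)) ((isClosed_boundary l).preimage (by fun_prop))
      (fun w => w.2) (β.1.continuous.comp (by fun_prop)).continuousOn
      (α.1.continuous.comp (by fun_prop)).continuousOn ?_ ?_
    · intro w hw
      exact if_pos hw
    · intro w hw
      split_ifs with h
      · exact (β.2 _ hw).trans (α.2 _ h).symm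
      · rfl

theorem whiteheadMap_left (α : GenLoop (Fin m) X x) (β : GenLoop (Fin l) X x)
    (w : prodBoundary m l) (h : w.1.1 ∈ Cube.boundary (Fin m)) : whiteheadMap α β w = β w.1.2 :=
  if_pos h

theorem whiteheadMap_right (α : GenLoop (Fin m) X x) (β : GenLoop (Fin l) X x)
    (w : prodBoundary m l) (h : w.1.2 ∈ Cube.boundary (Fin l)) : whiteheadMap α β w = α w.1.1 := by
  by_cases h' : w.1.1 ∈ Cube.boundary (Fin m)
  · rw [whiteheadMap_left α β w h']
    exact (β.2 _ h).trans (α.2 _ h').symm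
  · exact if_neg h'

theorem whiteheadMap_homotopicRel [NeZero m] [NeZero l] {α α' : GenLoop (Fin m) X x}
    {β β' : GenLoop (Fin l) X x} (hα : GenLoop.Homotopic α α') (hβ : GenLoop.Homotopic β β') :
    (whiteheadMap α β).HomotopicRel (whiteheadMap α' β') {basePt m l} := by
  classical
  obtain ⟨H⟩ := hα
  obtain ⟨K⟩ := hβ
  have hH : ∀ (s : I) (y), y ∈ Cube.boundary (Fin m) → H (s, y) = x := fun s y hy =>
    (H.eq_fst s hy).trans (α.2 y hy)
  have hK : ∀ (s : I) (y), y ∈ Cube.boundary (Fin l) → K (s, y) = x := fun s y hy =>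
    (K.eq_fst s hy).trans (β.2 y hy)
  refine ⟨⟨⟨⟨fun q : I × prodBoundary m l => if q.2.1.1 ∈ Cube.boundary (Fin m) then K (q.1, q.2.1.2)
    else H (q.1, q.2.1.1), ?_⟩, ?_, ?_⟩, ?_⟩⟩
  · refine continuous_glue (g₁ := fun q => K (q.1, q.2.1.2)) (g₂ := fun q => H (q.1, q.2.1.1))
      (C₁ := {q | q.2.1.1 ∈ Cube.boundary (Fin m)}) (C₂ := {q | q.2.1.2 ∈ Cube.boundary (Fin l)})
      ((isClosed_boundary m).preimage (by fun_prop)) ((isClosed_boundary l).preimage (by fun_prop))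
      (fun q => q.2.2) (K.continuous.comp (by fun_prop)).continuousOn
      (H.continuous.comp (by fun_prop)).continuousOn ?_ ?_
    · intro w hw
      exact if_pos hw
    · intro w hw
      split_ifs with h
      · exact (hK _ _ hw).trans (hH _ _ h).symm
      · rfl
  · intro w
    by_cases h : w.1.1 ∈ Cube.boundary (Fin m)
    · simp [h, whiteheadMap]
    · simp [h, whiteheadMap]
  · intro w
    by_cases h : w.1.1 ∈ Cube.boundary (Fin m)
    · simp [h, whiteheadMap]
    · simp [h, whiteheadMap]
  · rintro s w rfl
    have h0 : (basePt m l).1.1 ∈ Cube.boundary (Fin m) := zero_mem_boundary m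
    have h1 : (basePt m l).1.2 ∈ Cube.boundary (Fin l) := zero_mem_boundary l
    rw [whiteheadMap_left α β _ h0]
    change (if _ then _ else _) = _
    rw [if_pos h0]
    exact (hK _ _ h1).trans (β.2 _ h1).symm

/-- The Whitehead product `[α, β]` of `α ∈ π_m(X, x)` and `β ∈ π_l(X, x)`, for `m, l ≥ 1`, with the
sphere of dimension `m + l - 1` realized as `∂(I^m × I^l)`. -/
def whiteheadProduct [NeZero m] [NeZero l] (a : π_ m X x) (b : π_ l X x) :
    BasedClasses (basePt m l) x :=
  Quotient.liftOn₂ a b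
    (fun α β => Quotient.mk (basedSetoid (basePt m l) x) ⟨whiteheadMap α β,
      (whiteheadMap_left α β _ (zero_mem_boundary m)).trans (β.2 _ (zero_mem_boundary l))⟩)
    (fun _ _ _ _ hα hβ => Quotient.sound (whiteheadMap_homotopicRel hα hβ))

end Whitehead

/-! ### Stretching the cube -/

section Stretch

/-- Stretch the cube about its centre and clamp. -/
def stretch (m : ℕ) (s : I) (t : I^ Fin m) : I^ Fin m := fun i =>
  Set.projIcc (0 : ℝ) 1 zero_le_one (1 / 2 + (1 + (s : ℝ)) * ((t i : ℝ) - 1 / 2))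

/-- The centre of the cube. -/
def centre (m : ℕ) : I^ Fin m := fun _ => ⟨1 / 2, by norm_num, by norm_num⟩

variable {m : ℕ}

theorem continuous_stretch : Continuous fun q : I × (I^ Fin m) => stretch m q.1 q.2 := by
  unfold stretch
  refine continuous_pi fun i => continuous_projIcc.comp ?_
  fun_prop

theorem stretch_zero (t : I^ Fin m) : stretch m 0 t = t := by
  funext i
  have : (1 / 2 + (1 + ((0 : I) : ℝ)) * ((t i : ℝ) - 1 / 2)) = t i := by
    simp
  simp only [stretch, this]
  exact Set.projIcc_val _ _

theorem stretch_mem (s : I) {t : I^ Fin m} (ht : t ∈ Cube.boundary (Fin m)) :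
    stretch m s t ∈ Cube.boundary (Fin m) := by
  have hs := s.2.1
  obtain ⟨i, hi | hi⟩ := ht
  · refine ⟨i, Or.inl (Set.projIcc_of_le_left _ ?_)⟩
    rw [hi]
    norm_num
    linarith
  · refine ⟨i, Or.inr (Set.projIcc_of_right_le _ ?_)⟩
    rw [hi]
    norm_num
    linarith

theorem stretch_mem_of_le {t : I^ Fin m} (ht : 1 / 4 ≤ dist t (centre m)) :
    stretch m 1 t ∈ Cube.boundary (Fin m) := by
  by_contra hcon
  refine absurd ht (not_le.2 ((dist_pi_lt_iff (by norm_num)).2 fun i => ?_))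
  by_contra hi
  rw [not_lt, Subtype.dist_eq, Real.dist_eq] at hi
  simp only [centre] at hi
  refine hcon ⟨i, ?_⟩
  rcases le_abs.1 hi with h | h
  · refine Or.inr (Set.projIcc_of_right_le _ ?_)
    norm_num
    linarith
  · refine Or.inl (Set.projIcc_of_le_left _ ?_)
    norm_num
    linarith

theorem le_dist_of_mem {t : I^ Fin m} (ht : t ∈ Cube.boundary (Fin m)) :
    1 / 2 ≤ dist t (centre m) := by
  obtain ⟨i, hi⟩ := ht
  refine le_trans ?_ (dist_le_pi_dist t (centre m) i)
  rw [Subtype.dist_eq, Real.dist_eq]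
  rcases hi with hi | hi <;> rw [hi] <;> norm_num [centre, abs_le, le_abs]

/-- The collar coordinate: `0` where `r ≤ 1/4`, and `1` where `1/2 ≤ r`. -/
def collar (r : ℝ) : I := Set.projIcc (0 : ℝ) 1 zero_le_one (4 * r - 1)

theorem continuous_collar : Continuous collar :=
  continuous_projIcc.comp (by fun_prop)

theorem collar_quarter {r : ℝ} (h : r ≤ 1 / 4) : collar r = 0 :=
  Set.projIcc_of_le_left _ (by linarith)

theorem collar_half {r : ℝ} (h : 1 / 2 ≤ r) : collar r = 1 :=
  Set.projIcc_of_right_le _ (by linarith)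

variable {X : Type*} [TopologicalSpace X] {x : X}

/-- A generalized loop precomposed with the stretching map. -/
def stretchLoop (α : GenLoop (Fin m) X x) : GenLoop (Fin m) X x :=
  ⟨⟨fun t => α (stretch m 1 t), α.1.continuous.comp
    (continuous_stretch.comp (by fun_prop : Continuous fun t : I^ Fin m => ((1 : I), t)))⟩,
    fun _ ht => α.2 _ (stretch_mem 1 ht)⟩

theorem stretchLoop_homotopic (α : GenLoop (Fin m) X x) :
    GenLoop.Homotopic α (stretchLoop α) := by
  refine ⟨⟨⟨⟨fun q => α (stretch m q.1 q.2), α.1.continuous.comp continuous_stretch⟩, ?_, ?_⟩, ?_⟩⟩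
  · intro t
    change α (stretch m 0 t) = _
    rw [stretch_zero]
    rfl
  · intro t
    rfl
  · intro s t ht
    exact (α.2 _ (stretch_mem s ht)).trans (α.2 _ ht).symm

end Stretch

/-! ### Families of generalized loops -/

section Family

variable {B X : Type*} [TopologicalSpace B] [TopologicalSpace X] {m : ℕ}

theorem family_const (g : C(B, X)) : ∃ F : C(B × (I^ Fin m), X), ∀ b t, F (b, t) = g b :=
  ⟨g.comp ⟨Prod.fst, continuous_fst⟩, fun _ _ => rfl⟩

theorem continuous_update_proj (i : Fin m) {φ : ℝ → ℝ} (hφ : Continuous φ) :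
    Continuous fun q : B × (I^ Fin m) =>
      (q.1, Function.update q.2 i (Set.projIcc (0 : ℝ) 1 zero_le_one (φ (q.2 i)))) := by
  refine continuous_fst.prodMk (Continuous.update continuous_snd i (continuous_projIcc.comp ?_))
  fun_prop

theorem update_mem {i : Fin m} {t : I^ Fin m} {r : I}
    (h : t ∈ Cube.boundary (Fin m)) (hi : t i = 0 ∨ t i = 1 → r = 0 ∨ r = 1) :
    Function.update t i r ∈ Cube.boundary (Fin m) := by
  obtain ⟨j, hj⟩ := h
  by_cases hji : j = i
  · subst hji
    exact ⟨j, by simpa using hi hj⟩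
  · exact ⟨j, by simpa [Function.update_of_ne hji] using hj⟩

theorem family_trans (i : Fin m) (g : B → X) (F₁ F₂ : C(B × (I^ Fin m), X))
    (h₁ : ∀ b, ∀ t ∈ Cube.boundary (Fin m), F₁ (b, t) = g b)
    (h₂ : ∀ b, ∀ t ∈ Cube.boundary (Fin m), F₂ (b, t) = g b) :
    ∃ F : C(B × (I^ Fin m), X), (∀ b, ∀ t ∈ Cube.boundary (Fin m), F (b, t) = g b) ∧
      ∀ b t, F (b, t) = if (t i : ℝ) ≤ 1 / 2
        then F₁ (b, Function.update t i (Set.projIcc 0 1 zero_le_one (2 * t i)))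
        else F₂ (b, Function.update t i (Set.projIcc 0 1 zero_le_one (2 * t i - 1))) := by
  refine ⟨⟨fun q => if (q.2 i : ℝ) ≤ 1 / 2
        then F₁ (q.1, Function.update q.2 i (Set.projIcc 0 1 zero_le_one (2 * q.2 i)))
        else F₂ (q.1, Function.update q.2 i (Set.projIcc 0 1 zero_le_one (2 * q.2 i - 1))), ?_⟩,
    ?_, fun _ _ => rfl⟩
  · refine Continuous.if_le
      (F₁.continuous.comp (continuous_update_proj i (φ := fun r => 2 * r) (by fun_prop)))
      (F₂.continuous.comp (continuous_update_proj i (φ := fun r => 2 * r - 1) (by fun_prop)))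
      (by fun_prop) (by fun_prop) ?_
    intro q hq
    have e1 : (2 * (q.2 i : ℝ)) = 1 := by rw [hq]; norm_num
    rw [h₁ _ _ ⟨i, Or.inr ?_⟩, h₂ _ _ ⟨i, Or.inl ?_⟩]
    · rw [Function.update_self]
      exact Set.projIcc_of_le_left _ (by rw [e1]; norm_num)
    · rw [Function.update_self]
      exact Set.projIcc_of_right_le _ (by rw [e1])
  · intro b t ht
    simp only [ContinuousMap.coe_mk]
    split_ifs with h
    · refine h₁ _ _ (update_mem ht ?_)
      rintro (h0 | h0)
      · exact Or.inl (Set.projIcc_of_le_left _ (by simp [h0]))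
      · exact Or.inr (Set.projIcc_of_right_le _ (by simp [h0]))
    · refine h₂ _ _ (update_mem ht ?_)
      rintro (h0 | h0)
      · exact Or.inl (Set.projIcc_of_le_left _ (by simp [h0]))
      · exact Or.inr (Set.projIcc_of_right_le _ (by rw [h0]; norm_num))

theorem family_symm (i : Fin m) (g : B → X) (F₁ : C(B × (I^ Fin m), X))
    (h₁ : ∀ b, ∀ t ∈ Cube.boundary (Fin m), F₁ (b, t) = g b) :
    ∃ F : C(B × (I^ Fin m), X), (∀ b, ∀ t ∈ Cube.boundary (Fin m), F (b, t) = g b) ∧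
      ∀ b t, F (b, t) = F₁ (b, fun j => if j = i then σ (t i) else t j) := by
  refine ⟨⟨fun q => F₁ (q.1, fun j => if j = i then σ (q.2 i) else q.2 j), ?_⟩, ?_, fun _ _ => rfl⟩
  · refine F₁.continuous.comp (continuous_fst.prodMk (continuous_pi fun j => ?_))
    split_ifs <;> fun_prop
  · intro b t ht
    refine h₁ _ _ ?_
    obtain ⟨j, hj⟩ := ht
    refine ⟨j, ?_⟩
    by_cases hji : j = i
    · subst hji
      rcases hj with hj | hj <;> simp [hj]
    · simpa [hji] using hj

end Family

/-! ### Generalized Gottlieb groups -/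

section Gottlieb

variable {A X : Type*} [TopologicalSpace A] [TopologicalSpace X]

/-- `α ∈ π_m(X, x₀)` is represented by a map `α'` such that `f ∨ α' : A ∨ S^m → X` extends up to
based homotopy to a map `F : A × S^m → X`. Here `S^m = I^m / ∂I^m`, so that `F` is a map on
`A × I^m` that does not depend on `t` for `t ∈ ∂I^m`, a based map on `A ∨ S^m` is a pair of
based maps, and a based homotopy on `A ∨ S^m` is a pair of based homotopies. -/
def IsGottlieb (m : ℕ) (f : C(A, X)) (a₀ : A) (x₀ : X) (α : π_ m X x₀) : Prop :=
  ∃ (α' : GenLoop (Fin m) X x₀) (F : C(A × (I^ Fin m), X)) (g : C(A, X)),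
    (Quotient.mk _ α' : π_ m X x₀) = α ∧
    (∀ a, ∀ t ∈ Cube.boundary (Fin m), F (a, t) = g a) ∧
    g.HomotopicRel f {a₀} ∧
    (F.curry a₀).HomotopicRel α'.1 (Cube.boundary (Fin m))

variable {m : ℕ} {f : C(A, X)} {a₀ : A} {x₀ : X}

theorem isGottlieb_of_strict {α' : GenLoop (Fin m) X x₀} (F : C(A × (I^ Fin m), X))
    (hF : ∀ a, ∀ t ∈ Cube.boundary (Fin m), F (a, t) = f a) (hα : ∀ t, F (a₀, t) = α' t) :
    IsGottlieb m f a₀ x₀ (Quotient.mk _ α') := by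
  refine ⟨α', F, f, rfl, hF, ContinuousMap.HomotopicRel.refl _, ?_⟩
  have : F.curry a₀ = α'.1 := by ext t; exact hα t
  rw [this]
  exact ContinuousMap.HomotopicRel.refl _

theorem IsGottlieb.strict (hf : f a₀ = x₀) {α : π_ m X x₀} (h : IsGottlieb m f a₀ x₀ α) :
    ∃ (α' : GenLoop (Fin m) X x₀) (F : C(A × (I^ Fin m), X)),
      (Quotient.mk _ α' : π_ m X x₀) = α ∧
      (∀ a, ∀ t ∈ Cube.boundary (Fin m), F (a, t) = f a) ∧ ∀ t, F (a₀, t) = α' t := by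
  classical
  obtain ⟨α', F, g, rfl, hF, ⟨h⟩, hα⟩ := h
  have hg : g a₀ = x₀ := by
    have := h.fst_eq_snd (Set.mem_singleton a₀)
    exact this.trans hf
  have hh : ∀ s, h (s, a₀) = g a₀ := fun s => h.eq_fst s (Set.mem_singleton a₀)
  let β : GenLoop (Fin m) X x₀ := ⟨F.curry a₀, fun t ht => (hF a₀ t ht).trans hg⟩
  refine ⟨stretchLoop β, ⟨fun q => if dist q.2 (centre m) ≤ 1 / 4 then F (q.1, stretch m 1 q.2)
    else h (collar (dist q.2 (centre m)), q.1), ?_⟩, ?_, ?_, ?_⟩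
  · refine Continuous.if_le (F.continuous.comp (continuous_fst.prodMk (continuous_stretch.comp
      (continuous_const.prodMk continuous_snd)))) (h.continuous.comp
      ((continuous_collar.comp (by fun_prop)).prodMk continuous_fst)) (by fun_prop) (by fun_prop) ?_
    intro q hq
    rw [hF _ _ (stretch_mem_of_le hq.ge), collar_quarter hq.le]
    exact (h.apply_zero _).symm
  · refine Quotient.sound ?_
    exact (stretchLoop_homotopic β).symm.trans hα
  · intro a t ht
    have := le_dist_of_mem ht
    simp only [ContinuousMap.coe_mk]
    rw [if_neg (by linarith), collar_half this]
    exact h.apply_one _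
  · intro t
    simp only [ContinuousMap.coe_mk]
    split_ifs with ht
    · rfl
    · rw [hh]
      exact (hF _ _ (stretch_mem_of_le (not_le.1 ht).le)).symm

/-- The generalized Gottlieb group `G_m^f(X) ⊆ π_m(X, x₀)` of a based map `f : (A, a₀) → (X, x₀)`,
for `m ≥ 1`. -/
def gottliebGroup (m : ℕ) [NeZero m] (f : C(A, X)) {a₀ : A} {x₀ : X} (hf : f a₀ = x₀) :
    Subgroup (π_ m X x₀) where
  carrier := {α | IsGottlieb m f a₀ x₀ α}
  one_mem' := by
    obtain ⟨F, hF⟩ := family_const (m := m) f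
    exact isGottlieb_of_strict (α' := GenLoop.const) F (fun a t _ => hF a t)
      (fun t => (hF a₀ t).trans hf)
  mul_mem' := by
    intro a b ha hb
    obtain ⟨α, F₁, rfl, h₁, e₁⟩ := ha.strict hf
    obtain ⟨β, F₂, rfl, h₂, e₂⟩ := hb.strict hf
    obtain ⟨F, hF, eF⟩ := family_trans (0 : Fin m) f F₂ F₁ h₂ h₁
    have := isGottlieb_of_strict (a₀ := a₀) (α' := GenLoop.transAt 0 β α) F hF (fun t => by
      rw [eF, e₁, e₂]; rfl)
    rw [← HomotopyGroup.mul_spec] at this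
    exact this
  inv_mem' := by
    intro a ha
    obtain ⟨α, F₁, rfl, h₁, e₁⟩ := ha.strict hf
    obtain ⟨F, hF, eF⟩ := family_symm (0 : Fin m) f F₁ h₁
    have := isGottlieb_of_strict (a₀ := a₀) (α' := GenLoop.symmAt 0 α) F hF (fun t => by
      rw [eF, e₁]; rfl)
    rw [← HomotopyGroup.inv_spec] at this
    exact this

end Gottlieb

/-! ### Generalized Whitehead center groups -/

section WhiteheadCenter

variable {X : Type*} [TopologicalSpace X] {x : X} {m l : ℕ} [NeZero m] [NeZero l]

theorem whitehead_zero_of_extension {α : GenLoop (Fin m) X x} {β : GenLoop (Fin l) X x}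
    (F : C((I^ Fin l) × (I^ Fin m), X))
    (hF : ∀ z, ∀ t ∈ Cube.boundary (Fin m), F (z, t) = β z)
    (hα : ∀ z ∈ Cube.boundary (Fin l), ∀ t, F (z, t) = α t) :
    whiteheadProduct (Quotient.mk _ α : π_ m X x) (Quotient.mk _ β : π_ l X x) = 0 := by
  refine Quotient.sound ?_
  have h00 : F (0, 0) = x :=
    (hF 0 0 (zero_mem_boundary m)).trans (β.2 _ (zero_mem_boundary l))
  have hw : ∀ w : prodBoundary m l, F (w.1.2, w.1.1) = whiteheadMap α β w := by
    intro w
    rcases w.2 with h | h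
    · rw [whiteheadMap_left _ _ _ h, hF _ _ h]
    · rw [whiteheadMap_right _ _ _ h, hα _ h]
  refine ⟨⟨⟨⟨fun q => F (fun i => σ q.1 * q.2.1.2 i, fun i => σ q.1 * q.2.1.1 i), ?_⟩, ?_, ?_⟩, ?_⟩⟩
  · refine F.continuous.comp ((continuous_pi fun i => ?_).prodMk (continuous_pi fun i => ?_)) <;>
      fun_prop
  · intro w
    simpa using hw w
  · intro w
    have e1 : (fun i => σ (1 : I) * w.1.2 i) = (0 : I^ Fin l) := by funext i; simp
    have e2 : (fun i => σ (1 : I) * w.1.1 i) = (0 : I^ Fin m) := by funext i; simp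
    change F (fun i => σ (1 : I) * w.1.2 i, fun i => σ (1 : I) * w.1.1 i) = x
    rw [e1, e2, h00]
  · rintro s w rfl
    have e1 : (fun i => σ s * (basePt m l).1.2 i) = (0 : I^ Fin l) := by
      funext i; simp [basePt]
    have e2 : (fun i => σ s * (basePt m l).1.1 i) = (0 : I^ Fin m) := by
      funext i; simp [basePt]
    change F (fun i => σ s * (basePt m l).1.2 i, fun i => σ s * (basePt m l).1.1 i) = _
    rw [e1, e2]
    exact hw (basePt m l)

theorem extension_of_whitehead_zero {α : GenLoop (Fin m) X x} {β : GenLoop (Fin l) X x}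
    (h : whiteheadProduct (Quotient.mk _ α : π_ m X x) (Quotient.mk _ β : π_ l X x) = 0) :
    ∃ F : C((I^ Fin l) × (I^ Fin m), X),
      (∀ z, ∀ t ∈ Cube.boundary (Fin m), F (z, t) = stretchLoop β z) ∧
      ∀ z ∈ Cube.boundary (Fin l), ∀ t, F (z, t) = stretchLoop α t := by
  classical
  obtain ⟨H⟩ : (whiteheadMap α β).HomotopicRel (ContinuousMap.const _ x) {basePt m l} :=
    Quotient.exact h
  let c : (I^ Fin l) × (I^ Fin m) := (centre l, centre m)
  let st : (I^ Fin l) × (I^ Fin m) → (I^ Fin m) × (I^ Fin l) :=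
    fun q => (stretch m 1 q.2, stretch l 1 q.1)
  have hst : Continuous st :=
    (continuous_stretch.comp (continuous_const.prodMk continuous_snd)).prodMk
      (continuous_stretch.comp (continuous_const.prodMk continuous_fst))
  have hmem : ∀ q, 1 / 4 ≤ dist q c → st q ∈ prodBoundary m l := by
    intro q hq
    rw [Prod.dist_eq] at hq
    rcases le_max_iff.1 hq with h | h
    · exact Or.inr (stretch_mem_of_le h)
    · exact Or.inl (stretch_mem_of_le h)
  let G : (I^ Fin l) × (I^ Fin m) → X := fun q =>
    if hq : 1 / 4 ≤ dist q c then H (σ (collar (dist q c)), ⟨st q, hmem q hq⟩) else x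
  have hG3 : ∀ q (hq : 1 / 4 ≤ dist q c),
      G q = H (σ (collar (dist q c)), ⟨st q, hmem q hq⟩) := fun q hq => dif_pos hq
  have hG1 : ∀ q, dist q c ≤ 1 / 4 → G q = x := by
    intro q hq
    by_cases h' : 1 / 4 ≤ dist q c
    · simp only [G, dif_pos h', collar_quarter hq, unitInterval.symm_zero]
      exact H.apply_one _
    · exact dif_neg h'
  have hG2 : ∀ q, 1 / 2 ≤ dist q c → ∀ hs : st q ∈ prodBoundary m l,
      G q = whiteheadMap α β ⟨st q, hs⟩ := by
    intro q hq hs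
    have h' : 1 / 4 ≤ dist q c := by linarith
    simp only [G, dif_pos h', collar_half hq, unitInterval.symm_one]
    exact H.apply_zero _
  have hGc : Continuous G := by
    refine continuous_glue (g₁ := fun _ => x) (g₂ := G) (C₁ := {q | dist q c ≤ 1 / 4})
      (C₂ := {q | 1 / 4 ≤ dist q c}) (isClosed_le (by fun_prop) (by fun_prop))
      (isClosed_le (by fun_prop) (by fun_prop)) (fun q => le_total (dist q c) (1 / 4)) continuousOn_const ?_
      hG1 (fun _ _ => rfl)
    rw [continuousOn_iff_continuous_domRestrict]
    have hk : Continuous fun q : {q // 1 / 4 ≤ dist q c} => dist q.1 c :=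
      continuous_subtype_val.dist continuous_const
    have hu : Continuous fun q : {q // 1 / 4 ≤ dist q c} => σ (collar (dist q.1 c)) :=
      unitInterval.continuous_symm.comp (continuous_collar.comp hk)
    have hv : Continuous fun q : {q // 1 / 4 ≤ dist q c} =>
        (⟨st q.1, hmem q.1 q.2⟩ : prodBoundary m l) :=
      (hst.comp continuous_subtype_val).subtype_mk _
    have hH : Continuous fun q : {q // 1 / 4 ≤ dist q c} =>
        H (σ (collar (dist q.1 c)), ⟨st q.1, hmem q.1 q.2⟩) :=
      H.continuous.comp (hu.prodMk hv)
    refine hH.congr fun q => ?_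
    exact (hG3 q.1 q.2).symm
  refine ⟨⟨G, hGc⟩, ?_, ?_⟩
  · intro z t ht
    have hs : st (z, t) ∈ prodBoundary m l := Or.inl (stretch_mem 1 ht)
    refine (hG2 (z, t) ?_ hs).trans (whiteheadMap_left α β _ (stretch_mem 1 ht))
    rw [Prod.dist_eq]
    exact (le_dist_of_mem ht).trans (le_max_right _ _)
  · intro z hz t
    have hs : st (z, t) ∈ prodBoundary m l := Or.inr (stretch_mem 1 hz)
    refine (hG2 (z, t) ?_ hs).trans (whiteheadMap_right α β _ (stretch_mem 1 hz))
    rw [Prod.dist_eq]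
    exact (le_dist_of_mem hz).trans (le_max_left _ _)

theorem whitehead_one (b : π_ l X x) : whiteheadProduct (1 : π_ m X x) b = 0 := by
  induction b using Quotient.inductionOn with
  | h β =>
    obtain ⟨F, hF⟩ := family_const (m := m) β.1
    exact whitehead_zero_of_extension (α := GenLoop.const) F (fun z t _ => hF z t)
      (fun z hz t => (hF z t).trans (β.2 z hz))

theorem whitehead_mul {a b : π_ m X x} {c : π_ l X x} (ha : whiteheadProduct a c = 0)
    (hb : whiteheadProduct b c = 0) : whiteheadProduct (a * b) c = 0 := by
  induction a using Quotient.inductionOn with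
  | h α =>
  induction b using Quotient.inductionOn with
  | h β =>
  induction c using Quotient.inductionOn with
  | h γ =>
    obtain ⟨F₁, h₁, e₁⟩ := extension_of_whitehead_zero ha
    obtain ⟨F₂, h₂, e₂⟩ := extension_of_whitehead_zero hb
    obtain ⟨F, hF, eF⟩ := family_trans (0 : Fin m) _ F₂ F₁ h₂ h₁
    have := whitehead_zero_of_extension
      (α := GenLoop.transAt 0 (stretchLoop β) (stretchLoop α)) F hF (fun z hz t => by
        rw [eF, e₁ z hz, e₂ z hz]; rfl)
    rw [← HomotopyGroup.mul_spec] at this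
    have eα : (Quotient.mk _ (stretchLoop α) : π_ m X x) = Quotient.mk _ α :=
      Quotient.sound (stretchLoop_homotopic α).symm
    have eβ : (Quotient.mk _ (stretchLoop β) : π_ m X x) = Quotient.mk _ β :=
      Quotient.sound (stretchLoop_homotopic β).symm
    have eγ : (Quotient.mk _ (stretchLoop γ) : π_ l X x) = Quotient.mk _ γ :=
      Quotient.sound (stretchLoop_homotopic γ).symm
    rw [eα, eβ, eγ] at this
    exact this

theorem whitehead_inv {a : π_ m X x} {c : π_ l X x} (ha : whiteheadProduct a c = 0) :
    whiteheadProduct a⁻¹ c = 0 := by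
  induction a using Quotient.inductionOn with
  | h α =>
  induction c using Quotient.inductionOn with
  | h γ =>
    obtain ⟨F₁, h₁, e₁⟩ := extension_of_whitehead_zero ha
    obtain ⟨F, hF, eF⟩ := family_symm (0 : Fin m) _ F₁ h₁
    have := whitehead_zero_of_extension
      (α := GenLoop.symmAt 0 (stretchLoop α)) F hF (fun z hz t => by
        rw [eF, e₁ z hz]; rfl)
    rw [← HomotopyGroup.inv_spec] at this
    have eα : (Quotient.mk _ (stretchLoop α) : π_ m X x) = Quotient.mk _ α :=
      Quotient.sound (stretchLoop_homotopic α).symm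
    have eγ : (Quotient.mk _ (stretchLoop γ) : π_ l X x) = Quotient.mk _ γ :=
      Quotient.sound (stretchLoop_homotopic γ).symm
    rw [eα, eγ] at this
    exact this

/-- The generalized Whitehead center group `P_m^f(X) ⊆ π_m(X, x₀)` of a based map
`f : (A, a₀) → (X, x₀)`, for `m ≥ 1`: all `α` with `[α, f_* β] = 0` for all `β ∈ π_l(A, a₀)` and
all `l ≥ 1`. -/
def whiteheadCenter {A : Type*} [TopologicalSpace A] (m : ℕ) [NeZero m] (f : C(A, X)) {a₀ : A}
    {x₀ : X} (hf : f a₀ = x₀) : Subgroup (π_ m X x₀) where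
  carrier := {α | ∀ (l : ℕ) [NeZero l] (β : π_ l A a₀), whiteheadProduct α (piMap l f hf β) = 0}
  one_mem' := fun _ _ _ => whitehead_one _
  mul_mem' := fun ha hb l _ β => whitehead_mul (ha l β) (hb l β)
  inv_mem' := fun ha l _ β => whitehead_inv (ha l β)

end WhiteheadCenter

/-- The composite of based maps is based. -/
theorem comp_based {A E X : Type*} [TopologicalSpace A] [TopologicalSpace E] [TopologicalSpace X]
    {p : C(E, X)} {f : C(A, E)} {a₀ : A} {e₀ : E} {x₀ : X} (hf : f a₀ = e₀) (hp : p e₀ = x₀) :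
    (p.comp f) a₀ = x₀ := by
  rw [ContinuousMap.comp_apply, hf, hp]

end GenGottlieb

end

/-! Everything reduces to two properties of a covering map: homotopies lift, and two lifts of a map
on a connected space agree once they agree at one point. A homotopy relative to a set therefore
lifts to one relative to the same set, which gives injectivity of `p_*`. For `1 < m` the boundary of
the cube is connected, so a lifted loop is constant on it; this gives surjectivity.

For Gottlieb groups, an extension over `A × I^m` is pushed forward by composing with `p`.
Conversely, an extension `F` downstairs lifts (`exists_lift_family`) starting from `f` on `A × {0}`.
The lift may fail to return to `f` over the rest of the boundary when `m = 1`. It does return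
because the class comes from `π_m(E)`: the slice over `a₀` is then a closed loop, and uniqueness of
lifts on the connected space `A` carries the equality from `a₀` to every point.

For Whitehead centers, the product of projected classes is represented by `p` composed with the
product upstairs, and null-homotopies lift (`whiteheadProduct_piMap_eq_zero_iff`). The isomorphisms
for `1 < m` are restrictions of a bijective homomorphism to a preimage. -/

namespace GenGottlieb

/-! ### Connectedness of the boundary spheres -/

section Connectedness

theorem isPreconnected_face (m : ℕ) (i : Fin m) (c : I) :
    IsPreconnected {z : I^ Fin m | z i = c} := by
  have : {z : I^ Fin m | z i = c} = Set.range fun z : I^ Fin m => Function.update z i c := by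
    ext z
    refine ⟨fun h => ⟨z, ?_⟩, ?_⟩
    · rw [← h]
      exact Function.update_eq_self i z
    · rintro ⟨w, rfl⟩
      exact Function.update_self i c w
  rw [this]
  exact isPreconnected_range (continuous_id.update i continuous_const)

/-- A second coordinate `j ≠ i` exists, so the face through `y` meets the face `z j = 0`, which
contains the origin. For `m = 1` the boundary is two points. -/
theorem isPreconnected_boundary {m : ℕ} (hm : 1 < m) :
    IsPreconnected (Cube.boundary (Fin m)) := by
  have : Nontrivial (Fin m) := Fin.nontrivial_iff_two_le.2 hm
  refine isPreconnected_of_forall (0 : I^ Fin m) fun y ⟨i, hi⟩ => ?_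
  obtain ⟨j, hj⟩ := exists_ne i
  refine ⟨{z | z i = y i} ∪ {z | z j = 0}, ?_, Or.inr rfl, Or.inl rfl,
    (isPreconnected_face m i (y i)).union (Function.update (0 : I^ Fin m) i (y i)) ?_ ?_
      (isPreconnected_face m j 0)⟩
  · rintro z (hz | hz)
    · exact ⟨i, by rw [hz]; exact hi⟩
    · exact ⟨j, Or.inl hz⟩
  · simp
  · simp [hj]

/-- A full slice through `y` meets a full slice through the origin, and both lie in the boundary.
Only connectedness of the cubes is used, so `m = l = 1` is covered. -/
theorem isPreconnected_prodBoundary (m l : ℕ) [NeZero m] [NeZero l] :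
    IsPreconnected (prodBoundary m l) := by
  refine isPreconnected_of_forall ((0, 0) : (I^ Fin m) × (I^ Fin l)) fun y hy => ?_
  rcases hy with hy | hy
  · refine ⟨{y.1} ×ˢ Set.univ ∪ Set.univ ×ˢ {0}, ?_, Or.inr ⟨trivial, rfl⟩, Or.inl ⟨rfl, trivial⟩,
      (isPreconnected_singleton.prod isPreconnected_univ).union (y.1, 0) ⟨rfl, trivial⟩
        ⟨trivial, rfl⟩ (isPreconnected_univ.prod isPreconnected_singleton)⟩
    rintro z (⟨hz, -⟩ | ⟨-, hz⟩)
    · refine Or.inl ?_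
      rwa [Set.mem_singleton_iff.1 hz]
    · refine Or.inr ?_
      rw [Set.mem_singleton_iff.1 hz]
      exact zero_mem_boundary l
  · refine ⟨Set.univ ×ˢ {y.2} ∪ {0} ×ˢ Set.univ, ?_, Or.inr ⟨rfl, trivial⟩, Or.inl ⟨trivial, rfl⟩,
      (isPreconnected_univ.prod isPreconnected_singleton).union (0, y.2) ⟨trivial, rfl⟩
        ⟨rfl, trivial⟩ (isPreconnected_singleton.prod isPreconnected_univ)⟩
    rintro z (⟨-, hz⟩ | ⟨hz, -⟩)
    · refine Or.inr ?_
      rwa [Set.mem_singleton_iff.1 hz]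
    · refine Or.inl ?_
      rw [Set.mem_singleton_iff.1 hz]
      exact zero_mem_boundary m

instance (m l : ℕ) [NeZero m] [NeZero l] : PreconnectedSpace (prodBoundary m l) :=
  Subtype.preconnectedSpace (isPreconnected_prodBoundary m l)

end Connectedness

/-! ### Lifting families and loops along a covering -/

section Lifting

variable {B E X : Type*} [TopologicalSpace B] [TopologicalSpace E] [TopologicalSpace X]
  {p : C(E, X)} {m : ℕ} {e₀ : E} {x₀ : X}

/-- A map `B × I^m → X` lifts along a covering map, with a prescribed lift on `B × {0}`. -/
theorem exists_lift_family (hcov : IsCoveringMap p) (F : C(B × (I^ Fin m), X)) (g : C(B, E))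
    (hg : ∀ b, F (b, 0) = p (g b)) :
    ∃ G : C(B × (I^ Fin m), E), (∀ q, p (G q) = F q) ∧ ∀ b, G (b, 0) = g b := by
  let H : C(I × (B × (I^ Fin m)), X) :=
    F.comp ⟨fun q => (q.2.1, fun i => q.1 * q.2.2 i), by fun_prop⟩
  have hH : ∀ s b t, H (s, (b, t)) = F (b, fun i => s * t i) := fun _ _ _ => rfl
  have h0 : ∀ q, H (0, q) = p ((g.comp ContinuousMap.fst) q) := by
    rintro ⟨b, t⟩
    refine Eq.trans ?_ (hg b)
    rw [hH]
    congr 2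
    funext i
    simp
  let K := hcov.liftHomotopy H (g.comp ContinuousMap.fst) h0
  have hK : ∀ q, p (K q) = H q := fun q => congrFun (hcov.liftHomotopy_lifts H _ h0) q
  have hK0 : ∀ q, K (0, q) = g q.1 := fun q => hcov.liftHomotopy_zero H _ h0 q
  refine ⟨K.comp ⟨fun q => (1, q), by fun_prop⟩, ?_, ?_⟩
  · rintro ⟨b, t⟩
    refine (hK (1, (b, t))).trans ?_
    rw [hH]
    congr 2
    funext i
    simp
  · intro b
    refine Eq.trans ?_ (hK0 (b, 0))
    -- The contraction fixes `0`, so this path lifts a constant path.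
    refine hcov.const_of_comp (g := fun s : I => K (s, (b, 0))) (by fun_prop) ?_ 1 0
    intro s s'
    rw [hK, hK, hH, hH]
    congr 2
    funext i
    simp

/-- A generalized loop that is homotopic to the projection of `α` lifts to a generalized loop
homotopic to `α`. -/
theorem exists_lift_genLoop (hcov : IsCoveringMap p) (hp : p e₀ = x₀) {γ : GenLoop (Fin m) X x₀}
    {α : GenLoop (Fin m) E e₀} (h : GenLoop.Homotopic γ (compLoop p hp α)) :
    ∃ γ' : GenLoop (Fin m) E e₀, (∀ t, p (γ' t) = γ t) ∧ GenLoop.Homotopic γ' α := by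
  obtain ⟨H⟩ := h.symm
  have h0 : ∀ t, H (0, t) = p (α.1 t) := fun t => H.apply_zero t
  let K := hcov.liftHomotopy H.toContinuousMap α.1 h0
  have hK : ∀ q, p (K q) = H q := fun q => congrFun (hcov.liftHomotopy_lifts _ _ h0) q
  have hK0 : ∀ t, K (0, t) = α t := hcov.liftHomotopy_zero _ _ h0
  have hrel : ∀ s, ∀ t ∈ Cube.boundary (Fin m), K (s, t) = α t := by
    intro s t ht
    refine Eq.trans ?_ (hK0 t)
    refine hcov.const_of_comp (g := fun s : I => K (s, t)) (by fun_prop) ?_ s 0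
    intro s s'
    rw [hK, hK]
    exact (H.eq_fst s ht).trans (H.eq_fst s' ht).symm
  refine ⟨⟨K.comp ⟨fun t => (1, t), by fun_prop⟩, fun t ht => (hrel 1 t ht).trans (α.2 t ht)⟩,
    fun t => (hK (1, t)).trans (H.apply_one t), ?_⟩
  exact GenLoop.Homotopic.symm ⟨⟨⟨K, hK0, fun _ => rfl⟩, hrel⟩⟩

variable [NeZero m]

theorem piMap_injective (hcov : IsCoveringMap p) (hp : p e₀ = x₀) :
    Function.Injective (piMap m p hp) := by
  rintro ⟨α⟩ ⟨β⟩ h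
  have h' : (compLoop p hp α).1.HomotopicRel (compLoop p hp β).1 (Cube.boundary (Fin m)) :=
    Quotient.exact h
  exact Quotient.sound ((hcov.homotopicRel_iff_comp ⟨0, zero_mem_boundary m,
    (α.2 _ (zero_mem_boundary m)).trans (β.2 _ (zero_mem_boundary m)).symm⟩).2 h')

theorem piMap_surjective (hm : 1 < m) (hcov : IsCoveringMap p) (hp : p e₀ = x₀) :
    Function.Surjective (piMap m p hp) := by
  rintro ⟨γ⟩
  have h0 : γ 0 = x₀ := γ.2 _ (zero_mem_boundary m)
  -- A single loop is a family over a point.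
  obtain ⟨G, hG, hG0⟩ := exists_lift_family (B := Unit) hcov (γ.1.comp ContinuousMap.snd)
    (ContinuousMap.const _ e₀) (fun _ => h0.trans hp.symm)
  have hbd : ∀ t ∈ Cube.boundary (Fin m), G ((), t) = e₀ := by
    intro t ht
    refine Eq.trans ?_ (hG0 ())
    -- The lift stays in one discrete fibre along the connected boundary; this is where `1 < m`
    -- enters.
    refine hcov.constOn_of_comp (g := fun t => G ((), t)) (isPreconnected_boundary hm)
      (Continuous.continuousOn (by fun_prop)) ?_ ht (zero_mem_boundary m)
    intro a ha b hb
    rw [hG, hG]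
    exact (γ.2 a ha).trans (γ.2 b hb).symm
  refine ⟨Quotient.mk _ ⟨G.curry (), hbd⟩, congrArg (Quotient.mk _) ?_⟩
  ext t
  exact hG ((), t)

end Lifting

/-! ### Comparison of the Gottlieb and Whitehead center groups -/

section Subgroups

variable {A E X : Type*} [TopologicalSpace A] [TopologicalSpace E] [TopologicalSpace X]
  {p : C(E, X)} {f : C(A, E)} {a₀ : A} {e₀ : E} {x₀ : X} {m : ℕ} [NeZero m]

theorem piMap_comp (hf : f a₀ = e₀) (hp : p e₀ = x₀) (β : π_ m A a₀) :
    piMap m (p.comp f) (comp_based hf hp) β = piMap m p hp (piMap m f hf β) := by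
  induction β using Quotient.inductionOn
  rfl

theorem gottliebGroup_le_comap (hf : f a₀ = e₀) (hp : p e₀ = x₀) :
    gottliebGroup m f hf ≤
      (gottliebGroup m (p.comp f) (comp_based hf hp)).comap (piMap m p hp) := by
  intro α hα
  obtain ⟨α', F, rfl, hF, hα'⟩ := IsGottlieb.strict hf hα
  exact isGottlieb_of_strict (α' := compLoop p hp α') (p.comp F)
    (fun a t ht => congrArg p (hF a t ht)) (fun t => congrArg p (hα' t))

/-- Lift the extension from `f` on `A × {0}`, identify the slice over `a₀`, then spread the boundary
condition over `A` by uniqueness of lifts. -/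
theorem comap_gottliebGroup_le [PreconnectedSpace A] (hcov : IsCoveringMap p) (hf : f a₀ = e₀)
    (hp : p e₀ = x₀) :
    (gottliebGroup m (p.comp f) (comp_based hf hp)).comap (piMap m p hp) ≤
      gottliebGroup m f hf := by
  rintro ⟨α⟩ hα
  obtain ⟨γ, F, hγ, hF, hFγ⟩ := IsGottlieb.strict (comp_based hf hp) hα
  -- `γ` is only homotopic to the projection of `α`, so `α` is replaced by an exact lift of `γ` in
  -- the same class.
  obtain ⟨γ', hpγ', hγ'⟩ := exists_lift_genLoop hcov hp (γ := γ) (α := α) (Quotient.exact hγ)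
  obtain ⟨G, hG, hG0⟩ := exists_lift_family hcov F f (fun a => hF a 0 (zero_mem_boundary m))
  have hGγ : ∀ t, G (a₀, t) = γ' t := by
    refine congrFun (hcov.eq_of_comp_eq (g₁ := fun t => G (a₀, t)) (by fun_prop) γ'.1.continuous
      ?_ 0 ?_)
    · funext t
      exact (hG _).trans ((hFγ t).trans (hpγ' t).symm)
    · exact (hG0 a₀).trans (hf.trans (γ'.2 _ (zero_mem_boundary m)).symm)
  -- Uniqueness is applied along `A` with `t` fixed, not along the boundary of the cube, so `m = 1`
  -- needs no separate argument. The common value at `a₀` is `e₀`, because `γ'` is a loop.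
  have hGf : ∀ a, ∀ t ∈ Cube.boundary (Fin m), G (a, t) = f a := by
    intro a t ht
    refine congrFun (hcov.eq_of_comp_eq (g₁ := fun a => G (a, t)) (by fun_prop) f.continuous
      ?_ a₀ ?_) a
    · funext b
      exact (hG _).trans (hF b t ht)
    · exact (hGγ t).trans ((γ'.2 t ht).trans hf.symm)
  have := isGottlieb_of_strict (α' := γ') G hGf hGγ
  rwa [show (Quotient.mk _ γ' : π_ m E e₀) = Quotient.mk _ α from Quotient.sound hγ'] at this

/-- The representing map downstairs is `p` after the one upstairs, and the constant map at `x₀` is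
`p` after the constant map at `e₀`. On the connected sphere, based homotopies between such
composites lift. -/
theorem whiteheadProduct_piMap_eq_zero_iff {l : ℕ} [NeZero l] (hcov : IsCoveringMap p)
    (hp : p e₀ = x₀) (α : π_ m E e₀) (β : π_ l E e₀) :
    whiteheadProduct (piMap m p hp α) (piMap l p hp β) = 0 ↔ whiteheadProduct α β = 0 := by
  induction α using Quotient.inductionOn with
  | h α =>
  induction β using Quotient.inductionOn with
  | h β =>
    have hw : whiteheadMap (compLoop p hp α) (compLoop p hp β) = p.comp (whiteheadMap α β) := by
      ext w
      rcases w.2 with h | h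
      · rw [whiteheadMap_left _ _ w h, ContinuousMap.comp_apply, whiteheadMap_left _ _ w h]
        rfl
      · rw [whiteheadMap_right _ _ w h, ContinuousMap.comp_apply, whiteheadMap_right _ _ w h]
        rfl
    have hc : ContinuousMap.const (prodBoundary m l) x₀ =
        p.comp (ContinuousMap.const (prodBoundary m l) e₀) := by
      ext w
      exact hp.symm
    have key := hcov.homotopicRel_iff_comp (f₀ := whiteheadMap α β)
      (f₁ := ContinuousMap.const _ e₀) (S := {basePt m l})
      ⟨basePt m l, rfl, (whiteheadMap_left α β _ (zero_mem_boundary m)).trans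
        (β.2 _ (zero_mem_boundary l))⟩
    refine Iff.trans ?_ (key.symm.trans ?_)
    · refine Iff.trans Quotient.eq ?_
      change ContinuousMap.HomotopicRel (whiteheadMap (compLoop p hp α) (compLoop p hp β))
        (ContinuousMap.const _ x₀) _ ↔ _
      rw [hw, hc]
      rfl
    · exact Iff.symm Quotient.eq

theorem whiteheadCenter_eq_comap (hcov : IsCoveringMap p) (hf : f a₀ = e₀) (hp : p e₀ = x₀) :
    whiteheadCenter m f hf =
      (whiteheadCenter m (p.comp f) (comp_based hf hp)).comap (piMap m p hp) := by
  ext α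
  refine forall_congr' fun l => forall_congr' fun _ => forall_congr' fun β => ?_
  rw [piMap_comp hf hp, whiteheadProduct_piMap_eq_zero_iff hcov hp]

/-- Any preimage of an element of `L` lies in the comap automatically, so surjectivity of `φ` passes
to the restriction. -/
theorem exists_mulEquiv_of_eq_comap {G H : Type*} [Group G] [Group H] {φ : G →* H}
    (hφ : Function.Bijective φ) {K : Subgroup G} {L : Subgroup H} (h : K = L.comap φ) :
    ∃ ψ : K ≃* L, ∀ a, (ψ a : H) = φ a := by
  subst h
  refine ⟨MulEquiv.ofBijective (φ.subgroupComap L) ⟨fun a b hab => ?_, fun b => ?_⟩, fun _ => rfl⟩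
  · exact Subtype.ext (hφ.1 (congrArg Subtype.val hab))
  · obtain ⟨a, ha⟩ := hφ.2 b
    exact ⟨⟨a, by rw [Subgroup.mem_comap, ha]; exact b.2⟩, Subtype.ext ha⟩

end Subgroups

end GenGottlieb

open GenGottlieb in
theorem mainTheorem3 {A E X : Type*} [TopologicalSpace A] [TopologicalSpace E] [TopologicalSpace X]
    [PathConnectedSpace A] [PathConnectedSpace E] [PathConnectedSpace X]
    (p : C(E, X)) (hcov : IsCoveringMap p) (f : C(A, E))
    (a₀ : A) (e₀ : E) (x₀ : X) (hf : f a₀ = e₀) (hp : p e₀ = x₀)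
    (m : ℕ) [NeZero m] :
    Function.Injective (piMap m p hp) ∧
    gottliebGroup m f hf = (gottliebGroup m (p.comp f) (comp_based hf hp)).comap (piMap m p hp) ∧
    whiteheadCenter m f hf =
      (whiteheadCenter m (p.comp f) (comp_based hf hp)).comap (piMap m p hp) ∧
    (1 < m →
      Function.Bijective (piMap m p hp) ∧
      (∃ φ : gottliebGroup m f hf ≃* gottliebGroup m (p.comp f) (comp_based hf hp),
        ∀ α, (φ α : π_ m X x₀) = piMap m p hp α) ∧
      (∃ ψ : whiteheadCenter m f hf ≃* whiteheadCenter m (p.comp f) (comp_based hf hp),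
        ∀ α, (ψ α : π_ m X x₀) = piMap m p hp α)) := by
  have hG := le_antisymm (gottliebGroup_le_comap (m := m) hf hp)
    (comap_gottliebGroup_le hcov hf hp)
  have hP := whiteheadCenter_eq_comap (m := m) hcov hf hp
  refine ⟨piMap_injective hcov hp, hG, hP, fun hm => ?_⟩
  have hb : Function.Bijective (piMap m p hp) :=
    ⟨piMap_injective hcov hp, piMap_surjective hm hcov hp⟩
  exact ⟨hb, exists_mulEquiv_of_eq_comap hb hG, exists_mulEquiv_of_eq_comap hb hP⟩
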